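/- **Lemma (Tetrahedron Property).** Let $n\ge 2$. Let $\Delta$ be a locally finite building of type $\tilde A_{n-1}$, that is, a simplicial complex in which the link of every vertex is finite, with a system of subcomplexes (apartments), each isomorphic to the Coxeter complex of type $\tilde A_{n-1}$, such that any two simplices lie in a common apartment and any two apartments are isomorphic by an isomorphism fixing their intersection. Number the nodes of the Coxeter diagram cyclically by $1,\dots,n$ (for $n=2$ the Coxeter group is the infinite dihedral group), label the vertex $w\langle S\setminus\{s_i\}\rangle$ of the Coxeter complex by $i$, and let $\ell$ be a labeling of the vertices of $\Delta$ by $\{1,\dots,n\}$, regarded as residues modulo $n$, that restricts to this labeling on every apartment (under some identification of the apartment with the Coxeter complex). Let $\Gamma_\Delta$ be the directed graph whose vertices are the vertices of $\Delta$ and which has the two edges $x\to y$ and $y\to x$ for every $1$-simplex $\{x,y\}$ of $\Delta$; the edge $x\to y$ has as its label the representative of $\ell(x)-\ell(y)$ modulo $n$ in $\{0,\dots,n-1\}$. Let $a,b,c,d$ be vertices such that the cycles $a\to b\to c\to a$ and $a\to d\to b\to a$ exist in $\Gamma_\Delta$ and the sum of the labels of the edges $a\to d$, $d\to b$ and $b\to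 c$ is less than $n$. Then $c$ and $d$ are joined by an edge, and therefore the cycles $a\to c\to d\to a$ and $b\to d\to c\to b$ exist in $\Gamma_\Delta$. -/

import Mathlib

open scoped Pointwise

/-! ### Coxeter complexes -/

/-- The special subgroup `⟨J⟩` of the Coxeter group of `M` generated by a set `J` of simple
reflections. -/
def specialSubgroup {B : Type*} (M : CoxeterMatrix B) (J : Set B) : Subgroup M.Group :=
  Subgroup.closure (M.simple '' J)

/-- The special cosets `w⟨J⟩` other than the whole group, as subsets of the Coxeter group, ordered by
inclusion. (The whole group is the special coset that represents the empty simplex.) -/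
abbrev ProperSpecialCoset {B : Type*} (M : CoxeterMatrix B) : Type _ :=
  {C : Set M.Group // (∃ (w : M.Group) (J : Set B), C = w • (specialSubgroup M J : Set M.Group)) ∧
    C ≠ Set.univ}

/-- Isomorphisms of the simplicial complex `K`, given as its poset of (nonempty) simplices, with the
Coxeter complex of `M`: the poset of special cosets under reverse inclusion. -/
abbrev CoxeterComplexIso {B : Type*} (M : CoxeterMatrix B) {V : Type*}
    (K : PreAbstractSimplicialComplex V) : Type _ :=
  K ≃o (ProperSpecialCoset M)ᵒᵈ

/-- The Coxeter matrix of type `Ã_{n-1}`, with simple reflections indexed by `ZMod n`: the Coxeter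
diagram is the cycle through `1, 2, …, n = 0`; for `n = 2` the two reflections generate the infinite
dihedral group (the entry `0` stands for `∞`). Meaningful for `2 ≤ n`. -/
def affineAMatrix (n : ℕ) : CoxeterMatrix (ZMod n) where
  M := Matrix.of fun i j =>
    if i = j then 1 else if j = i + 1 ∨ i = j + 1 then (if n = 2 then 0 else 3) else 2
  isSymm := by
    ext i j
    simp only [Matrix.transpose_apply, Matrix.of_apply, eq_comm (a := j) (b := i),
      or_comm (a := i = j + 1)]
  diagonal := by simp
  off_diagonal := by
    intro i j h
    simp only [Matrix.of_apply, if_neg h]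
    split_ifs <;> norm_num

/-! ### Buildings -/

/-- `Δ` is a building and `𝒜` is a system of apartments for it. -/
structure IsBuilding {V : Type*} (Δ : AbstractSimplicialComplex V)
    (𝒜 : Set (PreAbstractSimplicialComplex V)) : Prop where
  /-- Apartments are subcomplexes. -/
  le : ∀ K ∈ 𝒜, K ≤ Δ.toPreAbstractSimplicialComplex
  /-- Each apartment is a Coxeter complex. -/
  coxeter : ∀ K ∈ 𝒜, ∃ (B : Type) (_ : Finite B) (M : CoxeterMatrix B),
    Nonempty (CoxeterComplexIso M K)
  /-- Some apartment contains the empty simplex. -/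
  nonempty : 𝒜.Nonempty
  /-- Any two simplices lie in a common apartment. -/
  common : ∀ s ∈ Δ, ∀ t ∈ Δ, ∃ K ∈ 𝒜, s ∈ K ∧ t ∈ K
  /-- Any two apartments are isomorphic by an isomorphism that fixes their intersection. -/
  iso : ∀ K ∈ 𝒜, ∀ L ∈ 𝒜, ∃ φ : K ≃o L, ∀ (s : Finset V) (hK : s ∈ K), s ∈ L →
    (φ ⟨s, hK⟩ : Finset V) = s

/-- The apartments in `𝒜` are Coxeter complexes of type `Ã_{n-1}`. -/
def IsTypeAffineA {V : Type*} (n : ℕ) (𝒜 : Set (PreAbstractSimplicialComplex V)) : Prop :=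
  ∀ K ∈ 𝒜, Nonempty (CoxeterComplexIso (affineAMatrix n) K)

/-- The link of a simplex `s`: the simplices that are disjoint from `s` and joinable to `s`. -/
def simplexLink {V : Type*} (Δ : AbstractSimplicialComplex V) (s : Finset V) : Set (Finset V) :=
  {t | t ∈ Δ ∧ Disjoint t s ∧ ∃ u ∈ Δ, t ⊆ u ∧ s ⊆ u}

/-- The link of every vertex is finite. -/
def IsLocallyFinite {V : Type*} (Δ : AbstractSimplicialComplex V) : Prop :=
  ∀ v : V, (simplexLink Δ {v}).Finite

/-- `ℓ` is a labeling of the vertices, by the elements of `{1, …, n}` read modulo `n`, that restricts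
on each apartment `K` to the canonical labeling of the Coxeter complex of type `Ã_{n-1}`: under some
identification of `K` with the Coxeter complex, every vertex `v` of `K` is a coset of the special
subgroup generated by all simple reflections except the one with index `ℓ v`. -/
def IsConsistentLabeling {V : Type*} (n : ℕ) (𝒜 : Set (PreAbstractSimplicialComplex V))
    (ℓ : V → ZMod n) : Prop :=
  ∀ K ∈ 𝒜, ∃ φ : CoxeterComplexIso (affineAMatrix n) K, ∀ (v : V) (hv : {v} ∈ K),
    ∃ w : (affineAMatrix n).Group,
      (OrderDual.ofDual (φ ⟨{v}, hv⟩)).1 =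
        w • (specialSubgroup (affineAMatrix n) {ℓ v}ᶜ : Set (affineAMatrix n).Group)

/-! ### The graph `Γ_Δ` -/

/-- The 1-skeleton of `Δ`: distinct vertices `x`, `y` are adjacent when `{x, y}` is a 1-simplex.
As a directed graph it has the edges `x → y` and `y → x` for each such pair. -/
def skeletonGraph {V : Type*} (Δ : AbstractSimplicialComplex V) : SimpleGraph V where
  Adj x y := x ≠ y ∧ ∃ e ∈ Δ, (e : Set V) = {x, y}
  symm := ⟨fun x y h => ⟨h.1.symm, by rw [Set.pair_comm]; exact h.2⟩⟩
  loopless := ⟨fun _ h => h.1 rfl⟩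

/-- The label of the edge `x → y`: the representative of `ℓ x - ℓ y mod n` in `{0, …, n - 1}`. -/
def edgeLabel {V : Type*} {n : ℕ} (ℓ : V → ZMod n) (x y : V) : ℕ :=
  (ℓ x - ℓ y).val

/-- The cycle `x → y → z → x` exists in the graph `Γ`. -/
def HasCycle {V : Type*} (Γ : SimpleGraph V) (x y z : V) : Prop :=
  Γ.Adj x y ∧ Γ.Adj y z ∧ Γ.Adj z x

/-!
Going around from `ℓ a`, the labels `ℓ a`, `ℓ d`, `ℓ b`, `ℓ c` are distinct and occur in this cyclic
order. Coxeter complexes have no empty triangles: three pairwise intersecting cosets of special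
subgroups have a common element, because every word has a reduced subword with the same product
(exchange condition) and the product of a reduced word determines its set of letters. Apartments
being full subcomplexes, `{a, b, c}` and `{a, b, d}` are therefore simplices, and some apartment
contains both. There they lie in chambers `g` and `h` with `g⁻¹ h` in the special subgroup generated
by the complement of `{ℓ a, ℓ b}`. Now `ℓ a` and `ℓ b` cut the cyclic diagram into two arcs, and the
reflections of one arc commute with those of the other, so `g⁻¹ h = u v` with `u` supported on the
arc of `ℓ d` and `v` on the arc of `ℓ c`. Since `u` does not involve `ℓ c` and `v` does not involve
`ℓ d`, the chamber `g u = h v⁻¹` contains both `c` and `d`.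
-/

section ReflectionRepresentation

open Module Polynomial.Chebyshev

theorem reflection_mul_reflection_pow_eq_one_of_mul_eq_two_pi {V : Type*} [AddCommGroup V]
    [Module ℝ V] {x y : V} {f g : Dual ℝ V} (hf : f x = 2) (hg : g y = 2) {m : ℕ} {θ : ℝ}
    (hmθ : m * θ = 2 * Real.pi) (hsin : Real.sin θ ≠ 0) (hfg : f y * g x = 2 * Real.cos θ + 2) :
    (reflection hf * reflection hg) ^ m = 1 := by
  have hS (k : ℤ) : (S ℝ k).eval (2 * Real.cos θ) = Real.sin ((k + 1) * θ) / Real.sin θ :=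
    eq_div_of_mul_eq hsin (S_two_mul_real_cos θ k)
  ext z
  rw [reflection_mul_reflection_pow_apply hf hg m z (2 * Real.cos θ) (by linarith)]
  obtain ⟨k, rfl | rfl⟩ := Nat.even_or_odd' m
  · have hSk : (S ℝ (k - 1)).eval (2 * Real.cos θ) = 0 := by
      have hkθ : (k : ℝ) * θ = Real.pi := by push_cast at hmθ; linarith
      simp [hS, hkθ]
    rw [show ((2 * k : ℕ) - 2 : ℤ) / 2 = k - 1 by omega,
      show ((2 * k : ℕ) - 1 : ℤ) / 2 = k - 1 by omega]
    simp [hSk]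
  · have hSk : (S ℝ k).eval (2 * Real.cos θ) + (S ℝ (k - 1)).eval (2 * Real.cos θ) = 0 := by
      have hkθ : ((k : ℝ) + 1) * θ = 2 * Real.pi - k * θ := by push_cast at hmθ; linarith
      simp [hS, hkθ, Real.sin_two_pi_sub, neg_div]
    rw [show ((2 * k + 1 : ℕ) - 1 : ℤ) / 2 = k by omega,
      show ((2 * k + 1 : ℕ) - 2 : ℤ) / 2 = k - 1 by omega,
      show ((2 * k + 1 : ℕ) - 3 : ℤ) / 2 = k - 1 by omega,
      show ((2 * k + 1 : ℕ) : ℤ) / 2 = k by omega]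
    simp [hSk]

theorem reflection_mul_reflection_pow_eq_one {V : Type*} [AddCommGroup V] [Module ℝ V] {x y : V}
    {f g : Dual ℝ V} (hf : f x = 2) (hg : g y = 2) {m : ℕ} (hm : m ≠ 1)
    (hfy : f y = -2 * Real.cos (Real.pi / m)) (hgx : g x = -2 * Real.cos (Real.pi / m)) :
    (reflection hf * reflection hg) ^ m = 1 := by
  obtain rfl | rfl | hm3 : m = 0 ∨ m = 2 ∨ 3 ≤ m := by omega
  · exact pow_zero _
  · have hfy0 : f y = 0 := by simp [hfy]
    have hgx0 : g x = 0 := by simp [hgx]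
    ext z
    simp only [pow_two, LinearEquiv.mul_apply, reflection_apply, map_sub, map_smul, hf, hg, hfy0,
      hgx0, LinearEquiv.coe_one, id_eq]
    module
  · have hm3' : (3 : ℝ) ≤ m := by exact_mod_cast hm3
    have hmθ : (m : ℝ) * (2 * (Real.pi / m)) = 2 * Real.pi := by field_simp
    refine reflection_mul_reflection_pow_eq_one_of_mul_eq_two_pi hf hg hmθ ?_ ?_
    · refine (Real.sin_pos_of_pos_of_lt_pi (by positivity) ?_).ne'
      nlinarith [Real.pi_pos]
    · rw [hfy, hgx, Real.cos_two_mul]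
      ring

variable {B W : Type*} [Group W] {M : CoxeterMatrix B}

/-- The simple coroot `α_j ↦ -2 cos (π / M i j)` of the reflection representation of a Coxeter group
on the real vector space with basis `(α_j)`. The entry `M i j = 0`, which stands for `∞`, gives the
value `-2`, since `π / 0 = 0`. -/
noncomputable def simpleCoroot (M : CoxeterMatrix B) (i : B) : Dual ℝ (B →₀ ℝ) :=
  Finsupp.linearCombination ℝ fun j => -2 * Real.cos (Real.pi / M i j)

theorem simpleCoroot_single (M : CoxeterMatrix B) (i j : B) :
    simpleCoroot M i (Finsupp.single j 1) = -2 * Real.cos (Real.pi / M i j) := by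
  simp [simpleCoroot]

theorem simpleCoroot_single_self (M : CoxeterMatrix B) (i : B) :
    simpleCoroot M i (Finsupp.single i 1) = 2 := by
  simp [simpleCoroot_single]

theorem isLiftable_reflection (M : CoxeterMatrix B) :
    M.IsLiftable fun i => reflection (simpleCoroot_single_self M i) := by
  intro i j
  obtain rfl | hij := eq_or_ne i j
  · rw [M.diagonal, pow_one]
    exact LinearEquiv.ext (involutive_reflection (simpleCoroot_single_self M i))
  · exact reflection_mul_reflection_pow_eq_one _ _ (M.off_diagonal i j hij)
      (simpleCoroot_single M i j) (M.symmetric i j ▸ simpleCoroot_single M j i)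

theorem simple_injective (cs : CoxeterSystem M W) : Function.Injective cs.simple := by
  intro i j h
  by_contra hij
  have hrefl := congrArg (cs.lift ⟨_, isLiftable_reflection M⟩) h
  rw [cs.lift_apply_simple, cs.lift_apply_simple] at hrefl
  have hcoord := congrArg (fun σ => σ (Finsupp.single i 1) i) hrefl
  norm_num [reflection_apply, Finsupp.single_apply, Ne.symm hij] at hcoord

end ReflectionRepresentation

section Exchange

open CoxeterSystem

variable {B W : Type*}

theorem prod_map_reverse_alternatingWord_two_mul {G : Type*} [Monoid G] (f : B → G) (i j : B)
    (m : ℕ) : ((alternatingWord j i (2 * m)).reverse.map f).prod = (f i * f j) ^ m := by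
  induction m with
  | zero => simp [alternatingWord]
  | succ m ih =>
    rw [Nat.mul_succ, alternatingWord_succ, alternatingWord_succ]
    rw [List.map_reverse] at ih
    simp [ih, pow_succ', mul_assoc]

variable [Group W] {M : CoxeterMatrix B} (cs : CoxeterSystem M W)

theorem exists_leftInvSeq_alternatingWord_eq_append_self (i j : B) :
    ∃ l : List W, cs.leftInvSeq (alternatingWord i j (2 * M i j)) = l ++ l := by
  refine ⟨List.ofFn fun k : Fin (M i j) => cs.wordProd (alternatingWord j i (2 * k + 1)), ?_⟩
  have halt (k : ℕ) : cs.wordProd (alternatingWord j i (2 * k + 1)) =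
      cs.simple i * (cs.simple j * cs.simple i) ^ k := by
    simp [prod_alternatingWord_eq_mul_pow, show (2 * k + 1) / 2 = k by omega]
  apply List.ext_getElem
  · simp [two_mul]
  · intro k hk _
    rw [cs.getElem_leftInvSeq_alternatingWord i j (M i j) k (by simpa using hk),
      List.getElem_append]
    split_ifs with hkM
    · simp
    · obtain ⟨r, rfl⟩ := Nat.exists_eq_add_of_le (show M i j ≤ k by simpa using hkM)
      simp [halt, pow_add]

open Classical in
/-- The action of the simple reflection `i` on `W × ZMod 2` from which Tits deduces the exchange
condition: conjugation on `W`, with a change of sign exactly at `cs.simple i`. On all of `W`,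
instead of just the reflections, it needs no invariance proof. -/
noncomputable def signedConj (i : B) : Function.End (W × ZMod 2) := fun p =>
  (cs.simple i * p.1 * cs.simple i, p.2 + if p.1 = cs.simple i then 1 else 0)

open Classical in
theorem prod_map_signedConj_apply (ω : List B) (p : W × ZMod 2) :
    (ω.map (signedConj cs)).prod p =
      (cs.wordProd ω * p.1 * (cs.wordProd ω)⁻¹, p.2 + ((cs.rightInvSeq ω).count p.1 : ℕ)) := by
  induction ω with
  | nil => simp [Function.End.one_def]
  | cons i ω ih =>
    have hconj : cs.wordProd ω * p.1 * (cs.wordProd ω)⁻¹ = cs.simple i ↔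
        (cs.wordProd ω)⁻¹ * cs.simple i * cs.wordProd ω = p.1 := by
      rw [mul_inv_eq_iff_eq_mul, mul_assoc, inv_mul_eq_iff_eq_mul, eq_comm]
    rw [List.map_cons, List.prod_cons]
    change signedConj cs i ((ω.map (signedConj cs)).prod p) = _
    rw [ih]
    simp only [signedConj, hconj, rightInvSeq, wordProd_cons, mul_inv_rev, inv_simple,
      List.count_cons, beq_iff_eq, Nat.cast_add, Nat.cast_ite, Nat.cast_one, Nat.cast_zero]
    simp only [mul_assoc, add_assoc]

theorem isLiftable_signedConj : M.IsLiftable (signedConj cs) := by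
  classical
  intro i j
  obtain ⟨l, hl⟩ := exists_leftInvSeq_alternatingWord_eq_append_self cs j i
  have hword : cs.wordProd (alternatingWord j i (2 * M j i)) = 1 := by
    simp [prod_alternatingWord_eq_mul_pow]
  -- The inversion sequence of the relator repeats its first half, so all sign changes cancel.
  have heven (t : W) : (((l ++ l).count t : ℕ) : ZMod 2) = 0 := by
    rw [List.count_append, Nat.cast_add, CharTwo.add_self_eq_zero]
  rw [M.symmetric i j, ← prod_map_reverse_alternatingWord_two_mul]
  funext p
  rw [prod_map_signedConj_apply, wordProd_reverse, hword, rightInvSeq_reverse, hl,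
    List.count_reverse, heven]
  simp [Function.End.one_def]

open Classical in
theorem count_rightInvSeq_eq_of_wordProd_eq {ω ρ : List B} (h : cs.wordProd ω = cs.wordProd ρ)
    (t : W) : ((cs.rightInvSeq ω).count t : ZMod 2) = (cs.rightInvSeq ρ).count t := by
  have hlift (ω : List B) : (ω.map (signedConj cs)).prod =
      cs.lift ⟨_, isLiftable_signedConj cs⟩ (cs.wordProd ω) := by
    simp [wordProd, map_list_prod, Function.comp_def]
  have hprod : (ω.map (signedConj cs)).prod (t, 0) = (ρ.map (signedConj cs)).prod (t, 0) := by
    rw [hlift, hlift, h]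
  simpa [prod_map_signedConj_apply] using congrArg Prod.snd hprod

theorem simple_mem_rightInvSeq_of_isRightDescent {ω : List B} {i : B}
    (h : cs.IsRightDescent (cs.wordProd ω) i) : cs.simple i ∈ cs.rightInvSeq ω := by
  classical
  obtain ⟨ρ, hρ, hωρ⟩ := cs.exists_isReduced (cs.wordProd ω * cs.simple i)
  have hprod : cs.wordProd ω = cs.wordProd (ρ.concat i) := by
    rw [wordProd_concat, ← hωρ, simple_mul_simple_cancel_right]
  have hred : cs.IsReduced (ρ.concat i) := by
    rw [CoxeterSystem.IsReduced, ← hprod, ← cs.isRightDescent_iff.1 h, hωρ, hρ.eq,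
      List.length_concat]
  have hcount := count_rightInvSeq_eq_of_wordProd_eq cs hprod (cs.simple i)
  have hlast : cs.simple i ∈ cs.rightInvSeq (ρ.concat i) := by
    rw [rightInvSeq_concat]
    simp
  rw [List.count_eq_one_of_mem hred.nodup_rightInvSeq hlast] at hcount
  by_contra hmem
  simp [List.count_eq_zero_of_not_mem hmem] at hcount

theorem exists_eraseIdx_of_isRightDescent {ω : List B} {i : B}
    (h : cs.IsRightDescent (cs.wordProd ω) i) :
    ∃ k < ω.length, cs.wordProd ω * cs.simple i = cs.wordProd (ω.eraseIdx k) := by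
  obtain ⟨k, hk, hki⟩ := List.getElem_of_mem (simple_mem_rightInvSeq_of_isRightDescent cs h)
  refine ⟨k, by simpa using hk, ?_⟩
  rw [← wordProd_mul_getD_rightInvSeq, List.getD_eq_getElem _ _ hk, hki]

theorem exists_sublist_isReduced (ω : List B) :
    ∃ ρ : List B, ρ.Sublist ω ∧ cs.IsReduced ρ ∧ cs.wordProd ρ = cs.wordProd ω := by
  induction ω using List.reverseRecOn with
  | nil => exact ⟨[], List.Sublist.refl _, by simp [CoxeterSystem.IsReduced], rfl⟩
  | append_singleton ω i ih =>
    obtain ⟨ρ, hsub, hred, hprod⟩ := ih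
    by_cases hdesc : cs.IsRightDescent (cs.wordProd ρ) i
    · obtain ⟨k, hk, hk'⟩ := exists_eraseIdx_of_isRightDescent cs hdesc
      refine ⟨ρ.eraseIdx k, ((List.eraseIdx_sublist _ _).trans hsub).trans
        (List.sublist_append_left _ _), ?_, ?_⟩
      · have hlen := cs.isRightDescent_iff.1 hdesc
        rw [hk', hred.eq] at hlen
        rw [CoxeterSystem.IsReduced, List.length_eraseIdx_of_lt hk]
        omega
      · rw [← hk', wordProd_append, hprod, wordProd_singleton]
    · refine ⟨ρ ++ [i], hsub.append_right [i], ?_, by simp [wordProd_append, hprod]⟩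
      rw [CoxeterSystem.IsReduced, wordProd_append, wordProd_singleton,
        cs.not_isRightDescent_iff.1 hdesc, hred.eq, List.length_append, List.length_singleton]

end Exchange

namespace specialSubgroup

open CoxeterSystem

variable {B : Type*} {M : CoxeterMatrix B} {I J K : Set B} {w : M.Group}

theorem mono (h : I ⊆ J) : specialSubgroup M I ≤ specialSubgroup M J :=
  Subgroup.closure_mono (Set.image_mono h)

theorem simple_mem {i : B} (hi : i ∈ J) : M.simple i ∈ specialSubgroup M J :=
  Subgroup.subset_closure (Set.mem_image_of_mem _ hi)

theorem wordProd_mem {ω : List B} (hω : ∀ i ∈ ω, i ∈ J) :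
    M.toCoxeterSystem.wordProd ω ∈ specialSubgroup M J := by
  refine Subgroup.list_prod_mem _ fun x hx => ?_
  obtain ⟨i, hi, rfl⟩ := List.mem_map.1 hx
  simpa using simple_mem (hω i hi)

theorem mem_iff_exists_wordProd :
    w ∈ specialSubgroup M J ↔
      ∃ ω : List B, (∀ i ∈ ω, i ∈ J) ∧ M.toCoxeterSystem.wordProd ω = w := by
  refine ⟨fun hw => ?_, ?_⟩
  · induction hw using Subgroup.closure_induction with
    | mem x hx =>
      obtain ⟨i, hi, rfl⟩ := hx
      exact ⟨[i], by simpa using hi, by simp⟩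
    | one => exact ⟨[], by simp, wordProd_nil _⟩
    | mul x y _ _ hx hy =>
      obtain ⟨ω, hω, rfl⟩ := hx
      obtain ⟨ρ, hρ, rfl⟩ := hy
      exact ⟨ω ++ ρ, fun i hi => (List.mem_append.1 hi).elim (hω i) (hρ i), wordProd_append _ _ _⟩
    | inv x _ hx =>
      obtain ⟨ω, hω, rfl⟩ := hx
      exact ⟨ω.reverse, by simpa using hω, wordProd_reverse _ _⟩
  · rintro ⟨ω, hω, rfl⟩
    exact wordProd_mem hω

theorem exists_isReduced_wordProd (hw : w ∈ specialSubgroup M J) :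
    ∃ ω : List B, (∀ i ∈ ω, i ∈ J) ∧ M.toCoxeterSystem.IsReduced ω ∧
      M.toCoxeterSystem.wordProd ω = w := by
  obtain ⟨ω, hω, rfl⟩ := mem_iff_exists_wordProd.1 hw
  obtain ⟨ρ, hsub, hred, hprod⟩ := exists_sublist_isReduced M.toCoxeterSystem ω
  exact ⟨ρ, fun i hi => hω i (hsub.subset hi), hred, hprod⟩

theorem simple_mem_iff {i : B} : M.simple i ∈ specialSubgroup M J ↔ i ∈ J := by
  refine ⟨fun h => ?_, simple_mem⟩
  obtain ⟨ω, hω, hred, hprod⟩ := exists_isReduced_wordProd h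
  have hlen : ω.length = 1 := by
    rw [← hred.eq, hprod, ← M.toCoxeterSystem_simple, length_simple]
  obtain ⟨j, rfl⟩ := List.length_eq_one_iff.1 hlen
  rw [wordProd_singleton, ← M.toCoxeterSystem_simple] at hprod
  exact simple_injective _ hprod ▸ hω j (List.mem_singleton_self j)

theorem mem_of_isRightDescent {i : B} (hw : w ∈ specialSubgroup M J)
    (hi : M.toCoxeterSystem.IsRightDescent w i) : i ∈ J := by
  obtain ⟨ω, hω, rfl⟩ := mem_iff_exists_wordProd.1 hw
  obtain ⟨k, -, hk⟩ := exists_eraseIdx_of_isRightDescent _ hi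
  have hwi : M.toCoxeterSystem.wordProd ω * M.toCoxeterSystem.simple i ∈ specialSubgroup M J :=
    hk ▸ wordProd_mem fun j hj => hω j (List.mem_of_mem_eraseIdx hj)
  rwa [Subgroup.mul_mem_cancel_left _ hw, M.toCoxeterSystem_simple, simple_mem_iff] at hwi

theorem wordProd_mem_iff_of_isReduced {ω : List B} (hred : M.toCoxeterSystem.IsReduced ω) :
    M.toCoxeterSystem.wordProd ω ∈ specialSubgroup M J ↔ ∀ i ∈ ω, i ∈ J := by
  refine ⟨fun h => ?_, wordProd_mem⟩
  induction ω using List.reverseRecOn with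
  | nil => simp
  | append_singleton ω i ih =>
    have hω : M.toCoxeterSystem.IsReduced ω := by simpa using hred.take ω.length
    have hdesc : M.toCoxeterSystem.IsRightDescent (M.toCoxeterSystem.wordProd (ω ++ [i])) i := by
      rw [IsRightDescent, hred.eq, wordProd_append, wordProd_singleton,
        simple_mul_simple_cancel_right, hω.eq, List.length_append]
      exact Nat.lt_succ_self _
    have hi : i ∈ J := mem_of_isRightDescent h hdesc
    rw [wordProd_append, wordProd_singleton, M.toCoxeterSystem_simple,
      Subgroup.mul_mem_cancel_right _ (simple_mem hi)] at h
    simpa [or_imp, forall_and, hi] using ih hω h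

theorem inf_eq : specialSubgroup M I ⊓ specialSubgroup M J = specialSubgroup M (I ∩ J) := by
  refine le_antisymm ?_ (le_inf (mono Set.inter_subset_left) (mono Set.inter_subset_right))
  rintro w ⟨hI, hJ⟩
  obtain ⟨ω, hω, hred, rfl⟩ := exists_isReduced_wordProd hI
  exact wordProd_mem fun i hi => ⟨hω i hi, (wordProd_mem_iff_of_isReduced hred).1 hJ i hi⟩

theorem exists_mul_eq_of_mul_mem {q r : M.Group} (hq : q ∈ specialSubgroup M J)
    (hr : r ∈ specialSubgroup M K) (hqr : q * r ∈ specialSubgroup M I) :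
    ∃ x ∈ specialSubgroup M (I ∩ J), ∃ y ∈ specialSubgroup M (I ∩ K), x * y = q * r := by
  obtain ⟨ω, hω, rfl⟩ := mem_iff_exists_wordProd.1 hq
  obtain ⟨ρ, hρ, rfl⟩ := mem_iff_exists_wordProd.1 hr
  obtain ⟨σ, hsub, hred, hprod⟩ := exists_sublist_isReduced M.toCoxeterSystem (ω ++ ρ)
  obtain ⟨ω', ρ', rfl, hω', hρ'⟩ := List.sublist_append_iff.1 hsub
  rw [wordProd_append _ ω] at hprod
  have hI := (wordProd_mem_iff_of_isReduced hred).1 (hprod ▸ hqr)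
  refine ⟨_, wordProd_mem fun i hi => ⟨hI i (List.mem_append_left _ hi), hω i (hω'.subset hi)⟩,
    _, wordProd_mem fun i hi => ⟨hI i (List.mem_append_right _ hi), hρ i (hρ'.subset hi)⟩, ?_⟩
  rw [← hprod, wordProd_append]

theorem exists_mul_eq_of_mem_union
    (hcomm : ∀ i ∈ I, ∀ j ∈ J, Commute (M.simple i) (M.simple j))
    (hw : w ∈ specialSubgroup M (I ∪ J)) :
    ∃ u ∈ specialSubgroup M I, ∃ v ∈ specialSubgroup M J, u * v = w := by
  have hcentral : specialSubgroup M J ≤ Subgroup.centralizer (specialSubgroup M I) := by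
    rw [specialSubgroup, specialSubgroup, Subgroup.centralizer_closure, Subgroup.closure_le]
    rintro _ ⟨j, hj, rfl⟩
    rw [SetLike.mem_coe, Subgroup.mem_centralizer_iff]
    rintro _ ⟨i, hi, rfl⟩
    exact hcomm i hi j hj
  rw [specialSubgroup, Set.image_union, Subgroup.closure_union, ← specialSubgroup,
    ← specialSubgroup, ← SetLike.mem_coe, Subgroup.coe_mul_of_right_le_normalizer_left _ _
      (hcentral.trans (Subgroup.centralizer_le_normalizer _))] at hw
  exact Set.mem_mul.1 hw

end specialSubgroup

theorem face_mem_of_subset {V : Type*} {K : PreAbstractSimplicialComplex V} {s t : Finset V}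
    (ht : t ∈ K) (hst : s ⊆ t) (hs : s.Nonempty) : s ∈ K :=
  (K.isRelLowerSet_faces ht).2 hst hs

namespace CoxeterComplexIso

variable {B V : Type*} {M : CoxeterMatrix B} {K : PreAbstractSimplicialComplex V}
  (φ : CoxeterComplexIso M K)

/-- The set of vertices of the chamber that corresponds to the group element `g`. -/
def chamber (g : M.Group) : Set V :=
  {v | ∃ hv : {v} ∈ K, g ∈ (OrderDual.ofDual (φ ⟨{v}, hv⟩)).1}

/-- The vertex `v` corresponds to a coset of the special subgroup generated by `J`, that is, it is a
vertex of `K` of cotype `J`. -/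
def HasCotype (J : Set B) (v : V) : Prop :=
  ∃ (hv : {v} ∈ K) (w : M.Group),
    (OrderDual.ofDual (φ ⟨{v}, hv⟩)).1 = w • (specialSubgroup M J : Set M.Group)

theorem exists_hasCotype {v : V} (hv : {v} ∈ K) : ∃ J, φ.HasCotype J v :=
  let ⟨w, J, hJ⟩ := (OrderDual.ofDual (φ ⟨{v}, hv⟩)).2.1
  ⟨J, hv, w, hJ⟩

theorem exists_subset_chamber {s : Finset V} (hs : s ∈ K) : ∃ g, ↑s ⊆ φ.chamber g := by
  obtain ⟨g, J, hgJ⟩ := (OrderDual.ofDual (φ ⟨s, hs⟩)).2.1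
  refine ⟨g, fun v hv => ?_⟩
  have hvs : {v} ⊆ s := Finset.singleton_subset_iff.2 hv
  have hvK : {v} ∈ K := face_mem_of_subset hs hvs (Finset.singleton_nonempty v)
  have hle : (OrderDual.ofDual (φ ⟨s, hs⟩)).1 ⊆ (OrderDual.ofDual (φ ⟨{v}, hvK⟩)).1 :=
    φ.monotone (show (⟨{v}, hvK⟩ : K) ≤ ⟨s, hs⟩ from hvs)
  refine ⟨hvK, hle ?_⟩
  rw [hgJ]
  exact mem_own_leftCoset (specialSubgroup M J).toSubmonoid g

variable {φ}

theorem mem_of_subset_chamber {s : Finset V} {g : M.Group} (hs : s.Nonempty)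
    (hsg : ↑s ⊆ φ.chamber g) : s ∈ K := by
  have hsingleton : ({g} : Set M.Group) ≠ Set.univ := by
    obtain ⟨v, hv⟩ := hs
    obtain ⟨hvK, hgv⟩ := hsg hv
    exact fun h => (OrderDual.ofDual (φ ⟨{v}, hvK⟩)).2.2
      (Set.univ_subset_iff.1 (h.ge.trans (Set.singleton_subset_iff.2 hgv)))
  let C : ProperSpecialCoset M := ⟨{g}, ⟨g, ∅, by simp [specialSubgroup]⟩, hsingleton⟩
  refine face_mem_of_subset (φ.symm (OrderDual.toDual C)).2 (fun v hv => ?_) hs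
  obtain ⟨hvK, hgv⟩ := hsg hv
  have hle : φ ⟨{v}, hvK⟩ ≤ OrderDual.toDual C := Set.singleton_subset_iff.2 hgv
  have hsub : {v} ⊆ (φ.symm (OrderDual.toDual C) : Finset V) := φ.le_symm_apply.2 hle
  exact Finset.singleton_subset_iff.1 hsub

namespace HasCotype

variable {I J : Set B} {g h : M.Group} {v w : V}

theorem mem_chamber_iff (hJ : φ.HasCotype J v) (hg : v ∈ φ.chamber g) :
    v ∈ φ.chamber h ↔ g⁻¹ * h ∈ specialSubgroup M J := by
  obtain ⟨hv, x, hx⟩ := hJ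
  have hmem (k : M.Group) : v ∈ φ.chamber k ↔ x⁻¹ * k ∈ specialSubgroup M J := by
    simp only [chamber, Set.mem_ofPred_eq, hv, exists_true_left, hx, mem_leftCoset_iff,
      SetLike.mem_coe]
  rw [hmem, show x⁻¹ * h = x⁻¹ * g * (g⁻¹ * h) by group,
    Subgroup.mul_mem_cancel_left _ ((hmem g).1 hg)]

theorem eq_of_mem_chamber (hv : φ.HasCotype J v) (hw : φ.HasCotype J w) (hvg : v ∈ φ.chamber g)
    (hwg : w ∈ φ.chamber g) : v = w := by
  have hcoset (h : M.Group) : v ∈ φ.chamber h ↔ w ∈ φ.chamber h := by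
    rw [hv.mem_chamber_iff hvg, hw.mem_chamber_iff hwg]
  obtain ⟨hvK, -⟩ := hvg
  obtain ⟨hwK, -⟩ := hwg
  have himage : φ ⟨{v}, hvK⟩ = φ ⟨{w}, hwK⟩ :=
    OrderDual.ofDual.injective <| Subtype.ext <| Set.ext fun h => by
      simpa [chamber, hvK, hwK] using hcoset h
  simpa using φ.injective himage

end HasCotype

variable [DecidableEq V]

theorem triple_mem (φ : CoxeterComplexIso M K) {x y z : V} (hxy : {x, y} ∈ K) (hyz : {y, z} ∈ K)
    (hzx : {z, x} ∈ K) : {x, y, z} ∈ K := by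
  obtain ⟨I, hI⟩ := φ.exists_hasCotype (v := x) (face_mem_of_subset hxy (by simp) (by simp))
  obtain ⟨J, hJ⟩ := φ.exists_hasCotype (v := y) (face_mem_of_subset hxy (by simp) (by simp))
  obtain ⟨L, hL⟩ := φ.exists_hasCotype (v := z) (face_mem_of_subset hyz (by simp) (by simp))
  obtain ⟨p, hp⟩ := φ.exists_subset_chamber hxy
  obtain ⟨q, hq⟩ := φ.exists_subset_chamber hyz
  obtain ⟨r, hr⟩ := φ.exists_subset_chamber hzx
  simp only [Finset.coe_insert, Finset.coe_singleton, Set.insert_subset_iff,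
    Set.singleton_subset_iff] at hp hq hr
  have hpq : p⁻¹ * q ∈ specialSubgroup M J := (hJ.mem_chamber_iff hp.2).1 hq.1
  have hqr : q⁻¹ * r ∈ specialSubgroup M L := (hL.mem_chamber_iff hq.2).1 hr.1
  have hpr : p⁻¹ * q * (q⁻¹ * r) ∈ specialSubgroup M I := by
    simpa [mul_assoc] using (hI.mem_chamber_iff hp.1).1 hr.2
  obtain ⟨u, hu, v, hv, huv⟩ := specialSubgroup.exists_mul_eq_of_mul_mem hpq hqr hpr
  refine mem_of_subset_chamber (φ := φ) (g := p * u) (by simp) ?_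
  simp only [Finset.coe_insert, Finset.coe_singleton, Set.insert_subset_iff,
    Set.singleton_subset_iff]
  refine ⟨(hI.mem_chamber_iff hp.1).2 ?_, (hJ.mem_chamber_iff hp.2).2 ?_,
    (hL.mem_chamber_iff hr.1).2 ?_⟩
  · simpa using specialSubgroup.mono Set.inter_subset_left hu
  · simpa using specialSubgroup.mono Set.inter_subset_right hu
  · have hrpu : r⁻¹ * (p * u) = v⁻¹ := by
      rw [eq_inv_iff_mul_eq_one, mul_assoc, mul_assoc, huv]
      group
    exact hrpu ▸ inv_mem (specialSubgroup.mono Set.inter_subset_right hv)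

theorem pair_mem_of_commute {a b c d : V} {Ja Jb Jc Jd I J : Set B} (ha : φ.HasCotype Ja a)
    (hb : φ.HasCotype Jb b) (hc : φ.HasCotype Jc c) (hd : φ.HasCotype Jd d)
    (habc : {a, b, c} ∈ K) (habd : {a, b, d} ∈ K) (hab : Ja ∩ Jb ⊆ I ∪ J) (hI : I ⊆ Jc)
    (hJ : J ⊆ Jd) (hcomm : ∀ i ∈ I, ∀ j ∈ J, Commute (M.simple i) (M.simple j)) :
    {c, d} ∈ K := by
  obtain ⟨g, hg⟩ := φ.exists_subset_chamber habc
  obtain ⟨h, hh⟩ := φ.exists_subset_chamber habd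
  simp only [Finset.coe_insert, Finset.coe_singleton, Set.insert_subset_iff,
    Set.singleton_subset_iff] at hg hh
  have hgh : g⁻¹ * h ∈ specialSubgroup M (Ja ∩ Jb) := specialSubgroup.inf_eq (M := M) ▸
    ⟨(ha.mem_chamber_iff hg.1).1 hh.1, (hb.mem_chamber_iff hg.2.1).1 hh.2.1⟩
  obtain ⟨u, hu, v, hv, huv⟩ :=
    specialSubgroup.exists_mul_eq_of_mem_union hcomm (specialSubgroup.mono hab hgh)
  have hcu : c ∈ φ.chamber (g * u) := by
    rw [hc.mem_chamber_iff hg.2.2, inv_mul_cancel_left]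
    exact specialSubgroup.mono hI hu
  have hdu : d ∈ φ.chamber (g * u) := by
    have hhgu : h⁻¹ * (g * u) = v⁻¹ := by
      rw [eq_inv_iff_mul_eq_one, mul_assoc, mul_assoc, huv]
      group
    rw [hd.mem_chamber_iff hh.2.2, hhgu]
    exact inv_mem (specialSubgroup.mono hJ hv)
  refine mem_of_subset_chamber (φ := φ) (g := g * u) (by simp) ?_
  simpa [Set.insert_subset_iff] using And.intro hcu hdu

end CoxeterComplexIso

theorem simple_commute_of_eq_two {B W : Type*} [Group W] {M : CoxeterMatrix B}
    (cs : CoxeterSystem M W) {i j : B} (hM : M i j = 2) :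
    Commute (cs.simple i) (cs.simple j) := by
  have hsq := cs.simple_mul_simple_pow i j
  rw [hM, pow_two] at hsq
  exact (eq_inv_of_mul_eq_one_left hsq).trans (by simp)

section AffineA

variable {n : ℕ}

theorem affineAMatrix_simple_commute {i j : ZMod n} (hij : i ≠ j + 1) (hji : j ≠ i + 1) :
    Commute ((affineAMatrix n).simple i) ((affineAMatrix n).simple j) := by
  obtain rfl | hne := eq_or_ne i j
  · exact Commute.refl _
  · have hM : affineAMatrix n i j = 2 := by
      change (if _ then _ else if _ then _ else _) = 2
      rw [if_neg hne, if_neg (not_or.2 ⟨hji, hij⟩)]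
    simpa using simple_commute_of_eq_two (affineAMatrix n).toCoxeterSystem hM

theorem affineAMatrix_simple_commute_of_val_lt [NeZero n] {A i j : ZMod n} {k : ℕ}
    (hi : 0 < (A - i).val) (hik : (A - i).val < k) (hkj : k < (A - j).val) :
    Commute ((affineAMatrix n).simple i) ((affineAMatrix n).simple j) := by
  have hn : 1 < n := by have := ZMod.val_lt (A - j); omega
  have : Fact (1 < n) := ⟨hn⟩
  refine affineAMatrix_simple_commute ?_ ?_
  · rintro rfl
    have hsub : A - (j + 1) = A - j - 1 := by ring
    rw [hsub, ZMod.val_sub (by rw [ZMod.val_one]; omega), ZMod.val_one] at hik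
    omega
  · rintro rfl
    have hsub : A - (i + 1) = A - i - 1 := by ring
    rw [hsub, ZMod.val_sub (by rw [ZMod.val_one]; omega), ZMod.val_one] at hkj
    omega

end AffineA

namespace IsConsistentLabeling

variable {n : ℕ} {V : Type*} {𝒜 : Set (PreAbstractSimplicialComplex V)} {ℓ : V → ZMod n}
  {K : PreAbstractSimplicialComplex V}

theorem exists_hasCotype (hℓ : IsConsistentLabeling n 𝒜 ℓ) (hK : K ∈ 𝒜) :
    ∃ φ : CoxeterComplexIso (affineAMatrix n) K, ∀ v, {v} ∈ K → φ.HasCotype {ℓ v}ᶜ v :=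
  let ⟨φ, hφ⟩ := hℓ K hK
  ⟨φ, fun v hv => ⟨hv, hφ v hv⟩⟩

variable [DecidableEq V]

theorem label_ne_of_pair_mem (hℓ : IsConsistentLabeling n 𝒜 ℓ) (hK : K ∈ 𝒜) {x y : V}
    (hxy : x ≠ y) (h : {x, y} ∈ K) : ℓ x ≠ ℓ y := by
  obtain ⟨φ, hφ⟩ := hℓ.exists_hasCotype hK
  obtain ⟨g, hg⟩ := φ.exists_subset_chamber h
  have hx := hφ x (face_mem_of_subset h (by simp) (by simp))
  have hy := hφ y (face_mem_of_subset h (by simp) (by simp))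
  intro hlabel
  rw [← hlabel] at hy
  exact hxy (hx.eq_of_mem_chamber hy (hg (by simp)) (hg (by simp)))

theorem pair_mem_of_edgeLabel_lt [NeZero n] (hℓ : IsConsistentLabeling n 𝒜 ℓ) (hK : K ∈ 𝒜)
    {a b c d : V} (habc : {a, b, c} ∈ K) (habd : {a, b, d} ∈ K)
    (hd : edgeLabel ℓ a d < edgeLabel ℓ a b) (hc : edgeLabel ℓ a b < edgeLabel ℓ a c) :
    {c, d} ∈ K := by
  obtain ⟨φ, hφ⟩ := hℓ.exists_hasCotype hK
  refine CoxeterComplexIso.pair_mem_of_commute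
    (I := {i | 0 < (ℓ a - i).val ∧ (ℓ a - i).val < edgeLabel ℓ a b})
    (J := {i | edgeLabel ℓ a b < (ℓ a - i).val})
    (hφ a (face_mem_of_subset habc (by simp) (by simp)))
    (hφ b (face_mem_of_subset habc (by simp) (by simp)))
    (hφ c (face_mem_of_subset habc (by simp) (by simp)))
    (hφ d (face_mem_of_subset habd (by simp) (by simp))) habc habd ?_ ?_ ?_ ?_
  · rintro i ⟨hia, hib⟩
    have ha : (ℓ a - i).val ≠ 0 := fun h => hia (sub_eq_zero.1 ((ZMod.val_eq_zero _).1 h)).symm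
    have hb : (ℓ a - i).val ≠ edgeLabel ℓ a b := fun h =>
      hib (sub_right_injective (ZMod.val_injective n h))
    exact hb.lt_or_gt.imp (fun h => ⟨Nat.pos_of_ne_zero ha, h⟩) id
  · rintro _ hi rfl
    exact hi.2.not_gt hc
  · rintro _ hi rfl
    exact lt_asymm hd hi
  · exact fun i hi j hj => affineAMatrix_simple_commute_of_val_lt hi.1 hi.2 hj

end IsConsistentLabeling

theorem skeletonGraph_adj_iff {V : Type*} [DecidableEq V] {Δ : AbstractSimplicialComplex V}
    {x y : V} : (skeletonGraph Δ).Adj x y ↔ x ≠ y ∧ {x, y} ∈ Δ := by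
  refine and_congr_right fun _ => ⟨?_, fun h => ⟨_, h, Finset.coe_pair⟩⟩
  rintro ⟨e, he, hexy⟩
  rw [← Finset.coe_pair, Finset.coe_inj] at hexy
  exact hexy ▸ he

theorem edgeLabel_eq_add {V : Type*} {n : ℕ} [NeZero n] {ℓ : V → ZMod n} {x y z : V}
    (h : edgeLabel ℓ x y + edgeLabel ℓ y z < n) :
    edgeLabel ℓ x z = edgeLabel ℓ x y + edgeLabel ℓ y z := by
  rw [edgeLabel, edgeLabel, edgeLabel, ← ZMod.val_add_of_lt h, sub_add_sub_cancel]

namespace IsBuilding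

variable {V : Type*} {Δ : AbstractSimplicialComplex V} {𝒜 : Set (PreAbstractSimplicialComplex V)}

theorem mem_of_forall_singleton_mem (hΔ : IsBuilding Δ 𝒜) {K : PreAbstractSimplicialComplex V}
    (hK : K ∈ 𝒜) {s : Finset V} (hs : s ∈ Δ) (hsK : ∀ v ∈ s, {v} ∈ K) : s ∈ K := by
  obtain ⟨L, hL, hsL, -⟩ := hΔ.common s hs s hs
  obtain ⟨φ, hφ⟩ := hΔ.iso L hL K hK
  refine face_mem_of_subset (φ ⟨s, hsL⟩).2 (fun v hv => ?_) (Δ.isRelLowerSet_faces hs).1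
  have hvs : {v} ⊆ s := Finset.singleton_subset_iff.2 hv
  have hvL : {v} ∈ L := face_mem_of_subset hsL hvs (Finset.singleton_nonempty v)
  have hle : (φ ⟨{v}, hvL⟩ : Finset V) ⊆ (φ ⟨s, hsL⟩ : Finset V) :=
    φ.monotone (show (⟨{v}, hvL⟩ : L) ≤ ⟨s, hsL⟩ from hvs)
  rw [hφ _ hvL (hsK v hv)] at hle
  exact Finset.singleton_subset_iff.1 hle

theorem triple_mem [DecidableEq V] (hΔ : IsBuilding Δ 𝒜) {x y z : V} (hxy : {x, y} ∈ Δ)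
    (hyz : {y, z} ∈ Δ) (hzx : {z, x} ∈ Δ) : {x, y, z} ∈ Δ := by
  obtain ⟨K, hK, hxyK, hz⟩ := hΔ.common _ hxy _ (Δ.singleton_mem z)
  obtain ⟨_, _, M, ⟨φ⟩⟩ := hΔ.coxeter K hK
  have hx : {x} ∈ K := face_mem_of_subset hxyK (by simp) (by simp)
  have hy : {y} ∈ K := face_mem_of_subset hxyK (by simp) (by simp)
  exact hΔ.le K hK (φ.triple_mem hxyK
    (hΔ.mem_of_forall_singleton_mem hK hyz (by simp [hy, hz]))
    (hΔ.mem_of_forall_singleton_mem hK hzx (by simp [hz, hx])))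

theorem edgeLabel_pos {n : ℕ} [NeZero n] {ℓ : V → ZMod n} (hΔ : IsBuilding Δ 𝒜)
    (hℓ : IsConsistentLabeling n 𝒜 ℓ) {x y : V} (h : (skeletonGraph Δ).Adj x y) :
    0 < edgeLabel ℓ x y := by
  classical
  obtain ⟨hne, hxy⟩ := skeletonGraph_adj_iff.1 h
  obtain ⟨K, hK, hxyK, -⟩ := hΔ.common _ hxy _ hxy
  rw [edgeLabel, ZMod.val_pos, sub_ne_zero]
  exact hℓ.label_ne_of_pair_mem hK hne hxyK

theorem triple_mem_of_hasCycle [DecidableEq V] (hΔ : IsBuilding Δ 𝒜) {x y z : V}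
    (h : HasCycle (skeletonGraph Δ) x y z) : {x, y, z} ∈ Δ :=
  hΔ.triple_mem (skeletonGraph_adj_iff.1 h.1).2 (skeletonGraph_adj_iff.1 h.2.1).2
    (skeletonGraph_adj_iff.1 h.2.2).2

end IsBuilding

theorem mainTheorem8_general {n : ℕ} {V : Type*} {Δ : AbstractSimplicialComplex V}
    {𝒜 : Set (PreAbstractSimplicialComplex V)} (hΔ : IsBuilding Δ 𝒜) {ℓ : V → ZMod n}
    (hℓ : IsConsistentLabeling n 𝒜 ℓ) {a b c d : V}
    (habc : HasCycle (skeletonGraph Δ) a b c) (hadb : HasCycle (skeletonGraph Δ) a d b)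
    (hsum : edgeLabel ℓ a d + edgeLabel ℓ d b + edgeLabel ℓ b c < n) :
    (skeletonGraph Δ).Adj c d ∧
      HasCycle (skeletonGraph Δ) a c d ∧ HasCycle (skeletonGraph Δ) b d c := by
  classical
  have : NeZero n := ⟨by omega⟩
  have hdb := hΔ.edgeLabel_pos hℓ hadb.2.1
  have hbc := hΔ.edgeLabel_pos hℓ habc.2.1
  have hab_eq : edgeLabel ℓ a b = edgeLabel ℓ a d + edgeLabel ℓ d b := edgeLabel_eq_add (by omega)
  have hac_eq : edgeLabel ℓ a c = edgeLabel ℓ a b + edgeLabel ℓ b c := edgeLabel_eq_add (by omega)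
  have hne : c ≠ d := by
    rintro rfl
    omega
  obtain ⟨K, hK, habcK, hadbK⟩ := hΔ.common _ (hΔ.triple_mem_of_hasCycle habc) _
    (hΔ.triple_mem_of_hasCycle hadb)
  rw [Finset.pair_comm d b] at hadbK
  have hcdK : {c, d} ∈ K := hℓ.pair_mem_of_edgeLabel_lt hK habcK hadbK (by omega) (by omega)
  have hcd : (skeletonGraph Δ).Adj c d := skeletonGraph_adj_iff.2 ⟨hne, hΔ.le K hK hcdK⟩
  exact ⟨hcd, ⟨habc.2.2.symm, hcd, hadb.1.symm⟩, ⟨hadb.2.1.symm, hcd.symm, habc.2.1.symm⟩⟩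

theorem mainTheorem8 {n : ℕ} (hn : 2 ≤ n) {V : Type*} (Δ : AbstractSimplicialComplex V)
    (𝒜 : Set (PreAbstractSimplicialComplex V)) (hΔ : IsBuilding Δ 𝒜) (htype : IsTypeAffineA n 𝒜)
    (hfin : IsLocallyFinite Δ) (ℓ : V → ZMod n) (hℓ : IsConsistentLabeling n 𝒜 ℓ)
    (a b c d : V)
    (habc : HasCycle (skeletonGraph Δ) a b c) (hadb : HasCycle (skeletonGraph Δ) a d b)
    (hsum : edgeLabel ℓ a d + edgeLabel ℓ d b + edgeLabel ℓ b c < n) :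
    (skeletonGraph Δ).Adj c d ∧
      HasCycle (skeletonGraph Δ) a c d ∧ HasCycle (skeletonGraph Δ) b d c := by
  exact mainTheorem8_general hΔ hℓ habc hadb hsum
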